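/- A dimension function is a (weakly) increasing, right-continuous function $h:[0,\infty)\to[0,\infty)$ with $h(0)=0$ and $h(t)>0$ for $t>0$; we write $h\prec x^2$ if $\lim_{x\to0^+} x^2/h(x)=0$. The associated Hausdorff measure is $$\mathcal H^h(E)=\lim_{\delta\to0}\inf\Big\{\sum_{i\in\mathbb N} h(\operatorname{diam} U_i) : E\subseteq\bigcup_{i\in\mathbb N} U_i,\ \operatorname{diam}U_i\le\delta\Big\}.$$ Let $(x_n,y_n,z_n)_{n\in\mathbb N}$ be a sequence of triples of pairwise distinct complex numbers. A similar copy of a triple is its image $\{f(x_n),f(y_n),f(z_n)\}$ under a similarity $f$ of the plane $\mathbb C$, that is, a bijection $f:\mathbb C\to\mathbb C$ such that for some $r>0$ one has $|f(u)-f(v)|=r|u-v|$ for all $u,v\in\mathbb C$ (orientation-reversing similarities are allowed). (1) For every dimension function $h$ with $h\prec x^2$ there is a compact set $E\subseteq\mathbb C$ with $\mathcal H^h(E)>0$ that contains no similar copy of any of the given triples. (2) In particular (the results of Maga and Falconer), there is a compact set $E\subseteq\mathbb C$ of Hausdorff dimension $2$ that contains no similar copy of any of the given triples. -/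

import Mathlib

open scoped NNReal ENNReal Topology

/-- A dimension function: a (weakly) increasing, right-continuous function
`h : [0, ∞) → [0, ∞)` with `h 0 = 0` and `h t > 0` for `t > 0`. -/
structure IsDimensionFunction (h : ℝ≥0 → ℝ≥0) : Prop where
  map_zero : h 0 = 0
  pos : ∀ t, 0 < t → 0 < h t
  mono : Monotone h
  right_continuous : ∀ t, ContinuousWithinAt h (Set.Ici t) t

/-- `DimPrec h₂ h₁` is the relation `h₂ ≺ h₁`, that is, `h₁ x / h₂ x → 0` as `x → 0⁺`. -/
def DimPrec (h₂ h₁ : ℝ≥0 → ℝ≥0) : Prop :=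
  Filter.Tendsto (fun x => h₁ x / h₂ x) (𝓝[>] 0) (𝓝 0)

/-- The Hausdorff measure associated with `h`: the limit (supremum) as `δ → 0` of the infimum of
`∑ i, h (diam (U i))` over countable coverings by sets of diameter at most `δ`. The value given to
sets of infinite diameter is immaterial, since `δ` may be taken finite. -/
noncomputable def hausdorffMeasureOf (h : ℝ≥0 → ℝ≥0) (X : Type*) [EMetricSpace X]
    [MeasurableSpace X] [BorelSpace X] : MeasureTheory.Measure X :=
  MeasureTheory.Measure.mkMetric fun d : ℝ≥0∞ => if d = ∞ then ∞ else (h d.toNNReal : ℝ≥0∞)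

/-- `E` contains a similar copy of `T`: the image of `T` under some similarity of the plane
(a bijection multiplying all distances by a constant `r > 0`; reflections are allowed). -/
def ContainsSimilarCopy (E T : Set ℂ) : Prop :=
  ∃ f : ℂ ≃ᵈ ℂ, f '' T ⊆ E

open MeasureTheory Filter AddCircle

/-! A similarity preserves the shape `m = (z - x) / (y - x)` up to conjugation, so a copy consists
of distinct points with `z₃ = (1 - m) z₁ + m z₂`, for countably many `m`. For each `m` and each
triple of disjoint basic open sets, force `t Re((1 - m) z)` and `t Re(m z)` to be within `1/8` of
integers on the first two sets and `t Re z` within `1/8` of a half-integer on the third; the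
relation then fails (`ne_of_mem_strips`).

Such strips cost little: their normalised densities tend weakly to `1` as `t → ∞`
(`exists_isUnitWeight_strip`). Start from a small constant density on a disc and multiply by one
weight after another. Since `h ≺ x²`, a bounded density passes all but finitely many of the tests
"mass of a net ball of radius `3 * 2⁻ʲ` is less than `h (2⁻ʲ)`"; the others, and the lower bound on
the mass, survive if `t` is large (`IsTestDensity.exists_mul`).

No limit measure is needed: by compactness an open cover of the final set covers a finite stage,
whose density bounds the covering sum (`hausdorffMeasureOf_iInter_pos`). Dimension `2` comes from
the gauge `x² log (e / x)`. -/

/-! ### Oscillating weights that converge weakly to the constant one -/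

theorem tendsto_integral_fourier_mul {n : ℤ} (hn : n ≠ 0) (l : StrongDual ℝ ℂ) (hl : l ≠ 0)
    (g : ℂ → ℂ) :
    Tendsto (fun t : ℕ => ∫ z, fourier n ((t * l z : ℝ) : UnitAddCircle) * g z) atTop (𝓝 0) := by
  -- The integral is the Fourier transform of `g` at the functional `-n t l`, which escapes to
  -- infinity: this is the Riemann–Lebesgue lemma.
  have hc : Tendsto (fun t : ℕ => (-(n : ℝ) * t) • l) atTop (cocompact (StrongDual ℝ ℂ)) := by
    rw [← Metric.cobounded_eq_cocompact, ← tendsto_norm_atTop_iff_cobounded]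
    simp_rw [norm_smul, norm_mul, norm_neg]
    have h0 : 0 < ‖(n : ℝ)‖ := by simpa using hn
    have h1 : 0 < ‖l‖ := norm_pos_iff.2 hl
    refine Tendsto.atTop_mul_const h1 (Tendsto.const_mul_atTop h0 ?_)
    simpa using tendsto_natCast_atTop_atTop (R := ℝ)
  refine ((tendsto_integral_exp_smul_cocompact g volume).comp hc).congr fun t => ?_
  refine integral_congr_ae (Eventually.of_forall fun z => ?_)
  simp only [fourier_coe_apply, Circle.smul_def, Real.fourierChar_apply, smul_eq_mul]
  congr 2
  simp
  ring

theorem continuous_coe_mul_apply (l : StrongDual ℝ ℂ) (t : ℝ) :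
    Continuous fun z => ((t * l z : ℝ) : UnitAddCircle) :=
  (AddCircle.continuous_mk' 1).comp (by fun_prop)

theorem integrable_comp_mul (w : C(UnitAddCircle, ℂ)) (l : StrongDual ℝ ℂ) (t : ℝ) {g : ℂ → ℂ}
    (hg : Integrable g) :
    Integrable fun z => w ((t * l z : ℝ) : UnitAddCircle) * g z :=
  hg.bdd_mul (w.continuous.comp (continuous_coe_mul_apply l t)).aestronglyMeasurable
    (Eventually.of_forall fun _ => w.norm_coe_le_norm _)

theorem integrable_haarAddCircle (w : C(UnitAddCircle, ℂ)) :
    Integrable w (haarAddCircle (T := 1)) :=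
  w.continuous.integrable_of_hasCompactSupport (HasCompactSupport.of_compactSpace _)

/-- A continuous function on the circle, evaluated along ever faster oscillating phases, converges
weakly to its mean. -/
theorem tendsto_integral_circle_mul (l : StrongDual ℝ ℂ) (hl : l ≠ 0) {g : ℂ → ℂ}
    (hg : Integrable g) (w : C(UnitAddCircle, ℂ)) :
    Tendsto (fun t : ℕ => ∫ z, w ((t * l z : ℝ) : UnitAddCircle) * g z) atTop
      (𝓝 ((∫ x, w x ∂haarAddCircle) * ∫ z, g z)) := by
  -- The `w` with the claimed limit form a subspace containing the characters, whose span is dense.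
  -- Uniform limits are harmless because both sides are Lipschitz in `w` with constant `∫ ‖g‖`.
  let S : Submodule ℂ C(UnitAddCircle, ℂ) :=
    { carrier := {w | Tendsto (fun t : ℕ => ∫ z, w ((t * l z : ℝ) : UnitAddCircle) * g z) atTop
        (𝓝 ((∫ x, w x ∂haarAddCircle) * ∫ z, g z))}
      add_mem' := by
        intro a b ha hb
        simp only [Set.mem_ofPred_eq, ContinuousMap.add_apply, add_mul]
        rw [integral_add (integrable_haarAddCircle a) (integrable_haarAddCircle b), add_mul]
        refine (ha.add hb).congr fun t => ?_
        rw [integral_add (integrable_comp_mul a l t hg) (integrable_comp_mul b l t hg)]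
      zero_mem' := by simp
      smul_mem' := by
        intro c a ha
        simp only [Set.mem_ofPred_eq, ContinuousMap.smul_apply, smul_eq_mul, mul_assoc,
          integral_const_mul]
        exact ha.const_mul c }
  have hS : Submodule.span ℂ (Set.range (fourier (T := 1))) ≤ S := by
    rw [Submodule.span_le]
    rintro _ ⟨n, rfl⟩
    rcases eq_or_ne n 0 with rfl | hn
    · simp [S]
    · have h0 : ∫ x, fourier n x ∂(haarAddCircle (T := 1)) = 0 := by
        have := integral_eq_zero_of_add_right_eq_neg (μ := haarAddCircle (T := 1))
          (fourier_add_half_inv_index hn one_pos)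
        exact this
      change Tendsto _ _ _
      rw [h0, zero_mul]
      exact tendsto_integral_fourier_mul hn l hl g
  have hw : w ∈ closure (S : Set C(UnitAddCircle, ℂ)) := by
    have h1 : w ∈ (Submodule.span ℂ (Set.range (fourier (T := 1)))).topologicalClosure := by
      rw [span_fourier_closure_eq_top]; trivial
    exact closure_mono hS h1
  rw [Metric.tendsto_atTop]
  intro ε hε
  set I := ∫ z, ‖g z‖ with hI
  have hI0 : 0 ≤ I := integral_nonneg fun _ => norm_nonneg _
  obtain ⟨v, hv, hvw⟩ := Metric.mem_closure_iff.1 hw (ε / (4 * (I + 1))) (by positivity)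
  obtain ⟨N, hN⟩ := Metric.tendsto_atTop.1 (show Tendsto _ _ _ from hv) (ε / 2) (half_pos hε)
  refine ⟨N, fun t ht => ?_⟩
  have hlt : ‖w - v‖ * I ≤ ε / 4 := by
    rw [dist_eq_norm] at hvw
    calc ‖w - v‖ * I ≤ (ε / (4 * (I + 1))) * (I + 1) := by gcongr; linarith
      _ = ε / 4 := by field_simp
  have h1 : ‖(∫ z, w ((t * l z : ℝ) : UnitAddCircle) * g z) -
      ∫ z, v ((t * l z : ℝ) : UnitAddCircle) * g z‖ ≤ ‖w - v‖ * I := by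
    rw [← integral_sub (integrable_comp_mul w l t hg) (integrable_comp_mul v l t hg), hI,
      ← integral_const_mul]
    refine norm_integral_le_of_norm_le (hg.norm.const_mul _) (Eventually.of_forall fun z => ?_)
    rw [← sub_mul, norm_mul]
    gcongr
    exact (w - v).norm_coe_le_norm _
  have h2 : ‖(∫ x, v x ∂haarAddCircle) * (∫ z, g z) - (∫ x, w x ∂haarAddCircle) * ∫ z, g z‖
      ≤ ‖w - v‖ * I := by
    rw [← sub_mul, norm_mul, norm_sub_rev,
      ← integral_sub (integrable_haarAddCircle w) (integrable_haarAddCircle v)]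
    gcongr
    · have := norm_integral_le_of_norm_le_const (μ := haarAddCircle (T := 1))
        (Eventually.of_forall fun x => (w - v).norm_coe_le_norm x)
      simpa using this
    · exact norm_integral_le_integral_norm _
  have h3 := hN t ht
  rw [dist_eq_norm] at h3 ⊢
  calc _ = ‖((∫ z, w ((t * l z : ℝ) : UnitAddCircle) * g z) -
        ∫ z, v ((t * l z : ℝ) : UnitAddCircle) * g z) +
        ((∫ z, v ((t * l z : ℝ) : UnitAddCircle) * g z) -
          (∫ x, v x ∂haarAddCircle) * ∫ z, g z) +
        ((∫ x, v x ∂haarAddCircle) * (∫ z, g z) - (∫ x, w x ∂haarAddCircle) * ∫ z, g z)‖ := by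
          congr 1; ring
    _ ≤ _ := norm_add₃_le
    _ < ε := by linarith

/-- A bounded sequence of nonnegative weights converging weakly to the constant `1`. -/
structure IsUnitWeight (φ : ℕ → ℂ → ℝ) (M : ℝ) : Prop where
  measurable : ∀ t, Measurable (φ t)
  nonneg : ∀ t z, 0 ≤ φ t z
  le : ∀ t z, φ t z ≤ M
  tendsto : ∀ g : ℂ → ℝ, Integrable g →
    Tendsto (fun t => ∫ z, φ t z * g z) atTop (𝓝 (∫ z, g z))

theorem isUnitWeight_one : IsUnitWeight (fun _ _ => 1) 1 :=
  ⟨fun _ => measurable_const, fun _ _ => zero_le_one, fun _ _ => le_rfl, fun g _ => by simp⟩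

theorem IsUnitWeight.integrable_mul {φ : ℕ → ℂ → ℝ} {M : ℝ} (hφ : IsUnitWeight φ M) (t : ℕ)
    {g : ℂ → ℝ} (hg : Integrable g) : Integrable fun z => φ t z * g z :=
  hg.bdd_mul (hφ.measurable t).aestronglyMeasurable (c := M)
    (Eventually.of_forall fun z => by
      rw [Real.norm_of_nonneg (hφ.nonneg t z)]; exact hφ.le t z)

-- Cutting `g` along `Q` lets each weight act on its own piece. This is what allows different strips
-- in different regions at one common frequency.
open Classical in
theorem IsUnitWeight.piecewise {φ ψ : ℕ → ℂ → ℝ} {M N : ℝ} (hφ : IsUnitWeight φ M)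
    (hψ : IsUnitWeight ψ N) {Q : Set ℂ} (hQ : MeasurableSet Q) :
    IsUnitWeight (fun t => Q.piecewise (φ t) (ψ t)) (max M N) := by
  refine ⟨fun t => (hφ.measurable t).piecewise hQ (hψ.measurable t), fun t z => ?_,
    fun t z => ?_, fun g hg => ?_⟩
  · by_cases hz : z ∈ Q <;> simp [hz, hφ.nonneg, hψ.nonneg]
  · by_cases hz : z ∈ Q <;> simp [hz, hφ.le, hψ.le]
  · have h1 := (hφ.tendsto _ (hg.indicator hQ)).add (hψ.tendsto _ (hg.indicator hQ.compl))
    rw [← integral_add (hg.indicator hQ) (hg.indicator hQ.compl)] at h1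
    convert! h1 using 2 with t
    · rw [← integral_add (hφ.integrable_mul t (hg.indicator hQ))
        (hψ.integrable_mul t (hg.indicator hQ.compl))]
      refine integral_congr_ae (Eventually.of_forall fun z => ?_)
      by_cases hz : z ∈ Q <;> simp [hz]
    · refine integral_congr_ae (Eventually.of_forall fun z => ?_)
      by_cases hz : z ∈ Q <;> simp [hz]

/-- For every arc around `a` there is a unit weight carried by strips in which a given linear
functional, read modulo `1` at frequency `t`, lies in the arc. -/
theorem exists_isUnitWeight_strip (l : StrongDual ℝ ℂ) (hl : l ≠ 0) (a : UnitAddCircle) {r : ℝ}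
    (hr : 0 < r) : ∃ φ M, IsUnitWeight φ M ∧
      ∀ t z, φ t z ≠ 0 → ‖((t * l z : ℝ) : UnitAddCircle) - a‖ ≤ r := by
  -- A tent over the arc; division by its mean `c` makes the weak limit `1`.
  let u : C(UnitAddCircle, ℝ) := ⟨fun x => max 0 (r - ‖x - a‖), by fun_prop⟩
  have hu0 : ∀ x, 0 ≤ u x := fun x => le_max_left _ _
  have hint : 0 < ∫ x, u x ∂haarAddCircle := by
    refine u.continuous.integral_pos_of_hasCompactSupport_nonneg_nonzero
      (HasCompactSupport.of_compactSpace _) hu0 (x := a) ?_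
    simp [u, hr.ne', hr.le]
  set c := ∫ x, u x ∂haarAddCircle with hc
  refine ⟨fun t z => c⁻¹ * u ((t * l z : ℝ) : UnitAddCircle), c⁻¹ * r,
    ⟨fun t => ?_, fun t z => ?_, fun t z => ?_, fun g hg => ?_⟩, fun t z hz => ?_⟩
  · exact ((u.continuous.comp (continuous_coe_mul_apply l t)).measurable).const_mul _
  · exact mul_nonneg (inv_nonneg.2 hint.le) (hu0 _)
  · have : u ((t * l z : ℝ) : UnitAddCircle) ≤ r :=
      max_le hr.le (by linarith [norm_nonneg (((t * l z : ℝ) : UnitAddCircle) - a)])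
    gcongr
  · let w : C(UnitAddCircle, ℂ) := ⟨fun x => (u x : ℂ), by fun_prop⟩
    have h := tendsto_integral_circle_mul l hl (show Integrable fun z => (g z : ℂ) from hg.ofReal) w
    have h' : ∀ t : ℕ, ∫ z, w ((t * l z : ℝ) : UnitAddCircle) * ((g z : ℝ) : ℂ) =
        ((∫ z, u ((t * l z : ℝ) : UnitAddCircle) * g z : ℝ) : ℂ) := fun t => by
      rw [← integral_complex_ofReal]
      simp [w]
    have hw : ∫ x, w x ∂haarAddCircle = (c : ℂ) := by
      rw [hc, ← integral_complex_ofReal]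
      rfl
    have h2 := (Complex.continuous_re.tendsto _).comp h
    simp only [Function.comp_def] at h2
    have h3 : Tendsto (fun t : ℕ => ∫ z, u ((t * l z : ℝ) : UnitAddCircle) * g z) atTop
        (𝓝 (c * ∫ z, g z)) := by
      convert! h2 using 2 with t
      · exact (congrArg Complex.re (h' t)).symm
      · rw [hw, integral_complex_ofReal, ← Complex.ofReal_mul, Complex.ofReal_re]
    have h4 := h3.const_mul c⁻¹
    rw [inv_mul_cancel_left₀ hint.ne'] at h4
    refine h4.congr fun t => ?_
    simp_rw [mul_assoc, integral_const_mul]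
  · by_contra! hlt
    exact hz (mul_eq_zero_of_right _ (max_eq_left (by linarith)))

/-! ### Test densities and the choice of frequencies -/

/-- A bounded nonnegative density carried by `K`, of total mass more than `c`, that gives each test
set `B i` a mass less than `b i`. -/
structure IsTestDensity {ι : Type*} (K : Set ℂ) (B : ι → Set ℂ) (b : ι → ℝ) (c : ℝ)
    (g : ℂ → ℝ) : Prop where
  measurable : Measurable g
  nonneg : ∀ z, 0 ≤ g z
  bounded : ∃ M, ∀ z, g z ≤ M
  support : ∀ z, g z ≠ 0 → z ∈ K
  integrable : Integrable g
  test : ∀ i, ∫ z in B i, g z < b i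
  mass : c < ∫ z, g z

section construction

variable {ι : Type*} {K : Set ℂ} {B : ι → Set ℂ} {b : ι → ℝ} {c : ℝ} {g : ℂ → ℝ}

theorem setIntegral_le_mul_volume {M : ℝ} {S : Set ℂ} (hS : volume S ≠ ∞) (hg : Integrable g)
    (hM : ∀ z, g z ≤ M) : ∫ z in S, g z ≤ M * volume.real S := by
  calc ∫ z in S, g z ≤ ∫ _ in S, M :=
        integral_mono hg.integrableOn (integrableOn_const hS) hM
    _ = M * volume.real S := by simp [mul_comm]

/-- All the new densities share one bound `M * N`, so by `hfin` only finitely many tests depend on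
`t`. These and the mass condition are strict inequalities between weakly convergent integrals and
constants, hence persist for large `t`. -/
theorem IsTestDensity.exists_mul (hB : ∀ i, MeasurableSet (B i)) (hBv : ∀ i, volume (B i) ≠ ∞)
    (hfin : ∀ M : ℝ, ∀ᶠ i in cofinite, M * volume.real (B i) < b i)
    (hg : IsTestDensity K B b c g) {φ : ℕ → ℂ → ℝ} {M : ℝ} (hφ : IsUnitWeight φ M) :
    ∃ t, IsTestDensity K B b c fun z => φ t z * g z := by
  obtain ⟨N, hN⟩ := hg.bounded
  have hM0 : 0 ≤ M := (hφ.nonneg 0 0).trans (hφ.le 0 0)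
  have hle : ∀ t z, φ t z * g z ≤ M * N := fun t z =>
    mul_le_mul (hφ.le t z) (hN z) (hg.nonneg z) hM0
  have hset : ∀ i t, ∫ z in B i, φ t z * g z = ∫ z, φ t z * (B i).indicator g z := fun i t => by
    rw [← integral_indicator (hB i)]
    refine integral_congr_ae (Eventually.of_forall fun z => ?_)
    by_cases hz : z ∈ B i <;> simp [hz]
  have h1 : ∀ᶠ t in atTop, ∀ i ∈ {i | ¬ (M * N * volume.real (B i) < b i)},
      ∫ z in B i, φ t z * g z < b i := by
    rw [eventually_all_finite (eventually_cofinite.1 (hfin (M * N)))]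
    intro i _
    simp_rw [hset]
    refine (hφ.tendsto _ (hg.integrable.indicator (hB i))).eventually_lt_const ?_
    rw [integral_indicator (hB i)]
    exact hg.test i
  have h2 : ∀ᶠ t in atTop, c < ∫ z, φ t z * g z :=
    (hφ.tendsto g hg.integrable).eventually_const_lt hg.mass
  obtain ⟨t, ht1, ht2⟩ := (h1.and h2).exists
  have hint := hφ.integrable_mul t hg.integrable
  refine ⟨t, (hφ.measurable t).mul hg.measurable, fun z => mul_nonneg (hφ.nonneg t z) (hg.nonneg z),
    ⟨M * N, hle t⟩, fun z hz => hg.support z (right_ne_zero_of_mul hz), hint, fun i => ?_, ht2⟩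
  by_cases hi : M * N * volume.real (B i) < b i
  · exact (setIntegral_le_mul_volume (hBv i) hint (hle t)).trans_lt hi
  · exact ht1 i hi

/-- A constant `a < 1` on `K` passes all but finitely many tests, and the remaining ones once `a` is
small. Half of its mass serves as `c`, to keep the inequality strict. -/
theorem exists_isTestDensity (hBv : ∀ i, volume (B i) ≠ ∞) (hb : ∀ i, 0 < b i)
    (hfin : ∀ M : ℝ, ∀ᶠ i in cofinite, M * volume.real (B i) < b i)
    (hK : IsCompact K) (hKv : 0 < volume K) :
    ∃ c > 0, ∃ g, IsTestDensity K B b c g := by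
  have h1 : ∀ᶠ a in 𝓝[>] (0 : ℝ), ∀ i ∈ {i | ¬ (1 * volume.real (B i) < b i)},
      a * volume.real (B i) < b i := by
    rw [eventually_all_finite (eventually_cofinite.1 (hfin 1))]
    intro i _
    have : Tendsto (fun a : ℝ => a * volume.real (B i)) (𝓝[>] 0) (𝓝 (0 * volume.real (B i))) :=
      (tendsto_id.mono_left nhdsWithin_le_nhds).mul_const _
    rw [zero_mul] at this
    exact this.eventually_lt_const (hb i)
  have h2 : ∀ᶠ a in 𝓝[>] (0 : ℝ), a ∈ Set.Ioo (0 : ℝ) 1 := Ioo_mem_nhdsGT one_pos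
  obtain ⟨a, ha, ha0, ha1⟩ := (h1.and h2).exists
  have hint : Integrable (K.indicator fun _ => a) :=
    (integrable_indicator_iff hK.measurableSet).2 (integrableOn_const hK.measure_lt_top.ne)
  have hmass : 0 < ∫ z, K.indicator (fun _ => a) z := by
    rw [integral_indicator hK.measurableSet]
    simp only [integral_const, MeasurableSet.univ, measureReal_restrict_apply, Set.univ_inter,
      smul_eq_mul]
    exact mul_pos (ENNReal.toReal_pos hKv.ne' hK.measure_lt_top.ne) ha0
  have hle : ∀ z, K.indicator (fun _ => a) z ≤ a := Set.indicator_le_self' fun _ _ => ha0.le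
  refine ⟨(∫ z, K.indicator (fun _ => a) z) / 2, by positivity, K.indicator fun _ => a,
    measurable_const.indicator hK.measurableSet, Set.indicator_nonneg fun _ _ => ha0.le, ⟨a, hle⟩,
    fun z hz => Set.mem_of_indicator_ne_zero hz, hint, fun i => ?_, half_lt_self hmass⟩
  refine (setIntegral_le_mul_volume (hBv i) hint hle).trans_lt ?_
  by_cases hi : 1 * volume.real (B i) < b i
  · exact (mul_le_mul_of_nonneg_right ha1.le measureReal_nonneg).trans_lt hi
  · exact ha i hi

/-- Frequencies can be chosen one after the other so that the successive truncations of the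
intersection of the sets carrying the weights all support test densities. -/
theorem exists_frequencies (hB : ∀ i, MeasurableSet (B i)) (hBv : ∀ i, volume (B i) ≠ ∞)
    (hb : ∀ i, 0 < b i) (hfin : ∀ M : ℝ, ∀ᶠ i in cofinite, M * volume.real (B i) < b i)
    (hK : IsCompact K) (hKv : 0 < volume K) {F : ℕ → ℕ → Set ℂ} {φ : ℕ → ℕ → ℂ → ℝ} {M : ℕ → ℝ}
    (hφ : ∀ n, IsUnitWeight (φ n) (M n)) (hF : ∀ n t z, φ n t z ≠ 0 → z ∈ F n t) :
    ∃ τ : ℕ → ℕ, ∃ c > 0, ∀ k, ∃ g, IsTestDensity (K ∩ ⋂ n < k, F n (τ n)) B b c g := by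
  obtain ⟨c, hc, g₀, hg₀⟩ := exists_isTestDensity hBv hb hfin hK hKv
  choose! T hT using fun (n : ℕ) (g : ℂ → ℝ) (hg : IsTestDensity K B b c g) =>
    hg.exists_mul hB hBv hfin (hφ n)
  -- The recursion records only that the support lies in `K`; the constraints are read off
  -- afterwards from the nonvanishing of the factors.
  let G : ℕ → ℂ → ℝ := fun n => Nat.rec g₀ (fun n g z => φ n (T n g) z * g z) n
  have hG : ∀ n, IsTestDensity K B b c (G n) := fun n => by
    induction n with
    | zero => exact hg₀
    | succ n ih => exact hT n _ ih
  refine ⟨fun n => T n (G n), c, hc, fun k => ⟨G k, { hG k with support := fun z hz => ?_ }⟩⟩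
  refine ⟨(hG k).support z hz, ?_⟩
  induction k with
  | zero => simp
  | succ k ih =>
    have hz' : φ k (T k (G k)) z * G k z ≠ 0 := hz
    have h1 := Set.mem_iInter₂.1 (ih (right_ne_zero_of_mul hz'))
    refine Set.mem_iInter₂.2 fun n hn => ?_
    rcases Nat.lt_succ_iff_lt_or_eq.1 hn with h | rfl
    · exact h1 n h
    · exact hF _ _ _ (left_ne_zero_of_mul hz')

end construction

/-! ### The mass distribution principle -/

/-- Closed balls of radius `3 * 2⁻ʲ` around the points of finite `2⁻ʲ`-nets, as test sets for a
gauge `h ≺ x²`. -/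
theorem eventually_mul_volume_closedBall_lt {h : ℝ≥0 → ℝ≥0} (hh : DimPrec h fun t => t ^ 2)
    (hpos : ∀ t, 0 < t → 0 < h t) (N : ℕ → Finset ℂ) (M : ℝ) :
    ∀ᶠ i : (Σ j, N j) in cofinite,
      M * volume.real (Metric.closedBall (i.2 : ℂ) (3 * (1 / 2) ^ i.1)) < h ((1 / 2) ^ i.1) := by
  have hlim : Tendsto (fun j : ℕ => ((1 / 2 : ℝ≥0)) ^ j) atTop (𝓝[>] 0) :=
    tendsto_nhdsWithin_iff.2 ⟨NNReal.tendsto_pow_atTop_nhds_zero_of_lt_one (by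
      rw [← NNReal.coe_lt_coe]; norm_num), Eventually.of_forall fun j => by
        simp⟩
  -- A test ball has area `9π (2⁻ʲ)²`, so the tests hold at all levels from some `J` on; the finite
  -- nets leave finitely many balls below `J`.
  have h1 := (NNReal.tendsto_coe.2 (hh.comp hlim)).const_mul (|M| * 9 * Real.pi)
  rw [NNReal.coe_zero, mul_zero] at h1
  obtain ⟨J, hJ⟩ := eventually_atTop.1 (h1.eventually_lt_const one_pos)
  rw [eventually_cofinite]
  have : (Set.range fun x : (Σ j : Fin J, N j) => (⟨x.1, x.2⟩ : Σ j, N j)).Finite :=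
    Set.finite_range _
  refine this.subset fun i hi => ?_
  have hij : i.1 < J := by
    by_contra! hij
    refine hi ?_
    have h2 := hJ i.1 hij
    have h3 : 0 < (h ((1 / 2) ^ i.1) : ℝ) := NNReal.coe_pos.2 (hpos _ (by positivity))
    simp only [Function.comp_apply, NNReal.coe_div, NNReal.coe_pow] at h2
    rw [← mul_div_assoc, div_lt_one h3] at h2
    refine lt_of_le_of_lt ?_ h2
    rw [Measure.real, Complex.volume_closedBall]
    simp only [ENNReal.toReal_mul, ENNReal.toReal_pow, ENNReal.coe_toReal, NNReal.coe_real_pi]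
    rw [ENNReal.toReal_ofReal (by positivity)]
    have := le_abs_self M
    push_cast
    calc M * ((3 * (1 / 2) ^ i.1) ^ 2 * Real.pi) ≤ |M| * ((3 * (1 / 2) ^ i.1) ^ 2 * Real.pi) := by
          gcongr
      _ = _ := by norm_num; ring
  exact ⟨⟨⟨i.1, hij⟩, i.2⟩, rfl⟩

theorem IsTestDensity.withDensity_eq {ι : Type*} {K : Set ℂ} {B : ι → Set ℂ} {b : ι → ℝ} {c : ℝ}
    {g : ℂ → ℝ} (hg : IsTestDensity K B b c g) {S : Set ℂ} (hS : MeasurableSet S) :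
    volume.withDensity (fun z => ENNReal.ofReal (g z)) S = ENNReal.ofReal (∫ z in S, g z) := by
  rw [withDensity_apply _ hS, ofReal_integral_eq_lintegral_ofReal hg.integrable.integrableOn
    (Eventually.of_forall hg.nonneg)]

/-- The mass of a set of diameter at most `d` is at most `h d`. -/
theorem IsTestDensity.withDensity_le {h : ℝ≥0 → ℝ≥0} (hmono : Monotone h) {K : Set ℂ}
    (hK : IsCompact K) {N : ℕ → Finset ℂ}
    (hN : ∀ j, K ⊆ ⋃ x ∈ N j, Metric.closedBall x ((1 / 2) ^ j)) {c : ℝ} {g : ℂ → ℝ}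
    (hg : IsTestDensity K
      (fun i : (Σ j, N j) => Metric.closedBall (i.2 : ℂ) (3 * (1 / 2) ^ i.1))
      (fun i => h ((1 / 2) ^ i.1)) c g)
    {U : Set ℂ} {d : ℝ≥0} (hd0 : 0 < d) (hd2 : d ≤ 2) (hU : ∀ x ∈ U, ∀ y ∈ U, dist x y ≤ d) :
    volume.withDensity (fun z => ENNReal.ofReal (g z)) U ≤ h d := by
  set μ := volume.withDensity (fun z => ENNReal.ofReal (g z)) with hμ
  have hKc : μ Kᶜ = 0 := by
    rw [hμ, hg.withDensity_eq hK.measurableSet.compl, setIntegral_eq_zero_of_forall_eq_zero,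
      ENNReal.ofReal_zero]
    intro z hz
    by_contra h0
    exact hz (hg.support z h0)
  have hUK : μ U ≤ μ (U ∩ K) := by
    calc μ U ≤ μ ((U ∩ K) ∪ Kᶜ) := measure_mono fun z hz => by
          by_cases h : z ∈ K
          · exact Or.inl ⟨hz, h⟩
          · exact Or.inr h
      _ ≤ μ (U ∩ K) + μ Kᶜ := measure_union_le _ _
      _ = μ (U ∩ K) := by rw [hKc, add_zero]
  refine hUK.trans ?_
  rcases (U ∩ K).eq_empty_or_nonempty with h0 | ⟨u, huU, huK⟩
  · simp [h0]
  -- Here `2⁻ʲ ≤ d ≤ 2 * 2⁻ʲ`. Points of `U` are within `2 * 2⁻ʲ` of `u`, which is within `2⁻ʲ` of a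
  -- net point: hence the radius `3 * 2⁻ʲ`.
  obtain ⟨j, hj1, hj2⟩ := exists_nat_pow_near_of_lt_one (x := d / 2) (y := (1 / 2 : ℝ≥0))
    (by positivity) (by rw [← NNReal.coe_le_coe] at hd2 ⊢; push_cast at hd2 ⊢; linarith)
    (by positivity) (by rw [← NNReal.coe_lt_coe]; norm_num)
  have hj1' : ((1 / 2 : ℝ≥0)) ^ j ≤ d := by
    rw [← NNReal.coe_lt_coe] at hj1
    rw [← NNReal.coe_le_coe]
    push_cast [pow_succ] at hj1 ⊢
    linarith
  have hj2' : (d : ℝ) ≤ 2 * (1 / 2) ^ j := by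
    rw [← NNReal.coe_le_coe] at hj2
    push_cast at hj2
    linarith
  obtain ⟨x, hx, hux⟩ := Set.mem_iUnion₂.1 (hN j huK)
  have hsub : U ∩ K ⊆ Metric.closedBall x (3 * (1 / 2) ^ j) := fun v hv => by
    rw [Metric.mem_closedBall] at hux ⊢
    linarith [dist_triangle v u x, hU v hv.1 u huU]
  calc μ (U ∩ K) ≤ μ (Metric.closedBall x (3 * (1 / 2) ^ j)) := measure_mono hsub
    _ = ENNReal.ofReal (∫ z in Metric.closedBall x (3 * (1 / 2) ^ j), g z) :=
        hg.withDensity_eq Metric.isClosed_closedBall.measurableSet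
    _ ≤ ENNReal.ofReal (h ((1 / 2) ^ j)) := ENNReal.ofReal_le_ofReal (hg.test ⟨j, ⟨x, hx⟩⟩).le
    _ = h ((1 / 2) ^ j) := ENNReal.ofReal_coe_nnreal
    _ ≤ h d := ENNReal.coe_le_coe.2 (hmono hj1')

/-- A set of finite diameter has an open neighbourhood whose gauge is hardly larger. -/
theorem IsDimensionFunction.exists_isOpen {h : ℝ≥0 → ℝ≥0} (hh : IsDimensionFunction h) {T : Set ℂ}
    (hT : Metric.ediam T ≤ 1) {ε : ℝ≥0} (hε : 0 < ε) :
    ∃ U, IsOpen U ∧ T ⊆ U ∧ ∃ d : ℝ≥0, 0 < d ∧ d ≤ 2 ∧ (∀ x ∈ U, ∀ y ∈ U, dist x y ≤ d) ∧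
      h d ≤ h (Metric.ediam T).toNNReal + ε := by
  set r := (Metric.ediam T).toNNReal with hr
  have hTr : Metric.ediam T = r := (ENNReal.coe_toNNReal (hT.trans_lt ENNReal.one_lt_top).ne).symm
  have hr1 : r ≤ 1 := by rw [hTr] at hT; exact_mod_cast hT
  -- Right-continuity leaves room for some `d > r`, and thickening `T` by `(d - r) / 2` uses up
  -- exactly that room.
  have h1 : ∀ᶠ s in 𝓝[>] r, h s < h r + ε :=
    ((hh.right_continuous r).mono_left (nhdsWithin_mono _ Set.Ioi_subset_Ici_self)).eventually_lt_const
      (lt_add_of_pos_right _ hε)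
  have h2 : ∀ᶠ s in 𝓝[>] r, s ∈ Set.Ioo r 2 :=
    Ioo_mem_nhdsGT (hr1.trans_lt (by rw [← NNReal.coe_lt_coe]; norm_num))
  obtain ⟨d, hd, hrd, hd2⟩ := (h1.and h2).exists
  have hrd' : (r : ℝ) < d := hrd
  refine ⟨Metric.thickening ((d - r) / 2) T, Metric.isOpen_thickening,
    Metric.self_subset_thickening (by linarith) _, d, pos_of_gt hrd, hd2.le, ?_, hd.le⟩
  intro x hx y hy
  obtain ⟨x', hx', hxx⟩ := Metric.mem_thickening_iff.1 hx
  obtain ⟨y', hy', hyy⟩ := Metric.mem_thickening_iff.1 hy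
  have h3 : dist x' y' ≤ r := by
    have := Metric.edist_le_ediam_of_mem hx' hy'
    rw [hTr, edist_nndist] at this
    exact_mod_cast this
  have := dist_triangle4 x x' y' y
  rw [dist_comm y' y] at this
  linarith

/-- A mass distribution principle for decreasing intersections. -/
theorem hausdorffMeasureOf_iInter_pos {h : ℝ≥0 → ℝ≥0} (hh : IsDimensionFunction h)
    {N : ℕ → Finset ℂ} {V : ℕ → Set ℂ} (hV : ∀ k, IsCompact (V k)) (hanti : Antitone V)
    (hN : ∀ j, V 0 ⊆ ⋃ x ∈ N j, Metric.closedBall x ((1 / 2) ^ j)) {c : ℝ} (hc : 0 < c)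
    (hg : ∀ k, ∃ g, IsTestDensity (V k)
      (fun i : (Σ j, N j) => Metric.closedBall (i.2 : ℂ) (3 * (1 / 2) ^ i.1))
      (fun i => h ((1 / 2) ^ i.1)) c g) :
    0 < hausdorffMeasureOf h ℂ (⋂ k, V k) := by
  -- Half of the mass `c` pays for the errors `ε n` of the open enlargements; the other half bounds
  -- the measure from below.
  have hc2 : ENNReal.ofReal (c / 2) ≠ 0 := by simpa using hc
  refine (pos_iff_ne_zero.2 hc2).trans_le ?_
  rw [hausdorffMeasureOf, Measure.mkMetric_apply]
  refine le_iSup₂_of_le 1 one_pos (le_iInf₂ fun T hT => le_iInf fun hdiam => ?_)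
  obtain ⟨ε, hε, hεc⟩ := ENNReal.exists_pos_sum_of_countable hc2 ℕ
  choose U hUo hTU d hd0 hd2 hUd hhd using fun n => hh.exists_isOpen (hdiam n) (hε n)
  -- Empty sets contribute nothing to the covering sum, so their neighbourhoods are discarded too.
  let W : ℕ → Set ℂ := fun n => {z | z ∈ U n ∧ (T n).Nonempty}
  have hWo : ∀ n, IsOpen (W n) := fun n => (hUo n).and isOpen_const
  have hsub : ⋂ k, V k ⊆ ⋃ n, W n := fun z hz => by
    obtain ⟨n, hn⟩ := Set.mem_iUnion.1 (hT hz)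
    exact Set.mem_iUnion.2 ⟨n, hTU n hn, z, hn⟩
  -- Compactness: the open cover of the intersection already covers a single `V k`.
  obtain ⟨k, hk⟩ := exists_subset_nhds_of_isCompact' hanti.directed_ge hV
    (fun k => (hV k).isClosed) fun z hz => (isOpen_iUnion hWo).mem_nhds (hsub hz)
  obtain ⟨g, hg⟩ := hg k
  set μ := volume.withDensity (fun z => ENNReal.ofReal (g z)) with hμ
  have hWle : ∀ n, μ (W n) ≤
      (⨆ _ : (T n).Nonempty, if Metric.ediam (T n) = ∞ then ∞ else
        (h (Metric.ediam (T n)).toNNReal : ℝ≥0∞)) + ε n := fun n => by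
    by_cases hne : (T n).Nonempty
    · have hfin : Metric.ediam (T n) ≠ ∞ := ((hdiam n).trans_lt ENNReal.one_lt_top).ne
      rw [iSup_pos hne, if_neg hfin]
      calc μ (W n) ≤ h (d n) := hg.withDensity_le hh.mono (hV k)
            (fun j => (hanti (Nat.zero_le k)).trans (hN j)) (hd0 n) (hd2 n)
            fun x hx y hy => hUd n x hx.1 y hy.1
        _ ≤ _ := by exact_mod_cast hhd n
    · simp [W, hne]
  have hmass : ENNReal.ofReal c ≤ ∑' n, μ (W n) := by
    calc ENNReal.ofReal c ≤ ENNReal.ofReal (∫ z, g z) := ENNReal.ofReal_le_ofReal hg.mass.le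
      _ = ENNReal.ofReal (∫ z in V k, g z) := by
          rw [setIntegral_eq_integral_of_forall_compl_eq_zero]
          intro z hz
          by_contra h0
          exact hz (hg.support z h0)
      _ = μ (V k) := (hg.withDensity_eq (hV k).measurableSet).symm
      _ ≤ μ (⋃ n, W n) := measure_mono hk
      _ ≤ _ := measure_iUnion_le _
  have htot := hmass.trans (ENNReal.tsum_le_tsum hWle)
  rw [ENNReal.tsum_add] at htot
  have hcc : ENNReal.ofReal c = ENNReal.ofReal (c / 2) + ENNReal.ofReal (c / 2) := by
    rw [← ENNReal.ofReal_add (by positivity) (by positivity), add_halves]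
  rw [hcc] at htot
  exact (ENNReal.add_le_add_iff_right ENNReal.ofReal_ne_top).1
    (htot.trans (add_le_add_right hεc.le _))

/-- Countably many closed constraints, each carrying unit weights, can be imposed at suitable
frequencies on a compact set of positive `h`-measure. -/
theorem exists_isCompact_hausdorffMeasureOf_pos {h : ℝ≥0 → ℝ≥0} (hh : IsDimensionFunction h)
    (hprec : DimPrec h fun t => t ^ 2) {F : ℕ → ℕ → Set ℂ} (hFc : ∀ n t, IsClosed (F n t))
    {φ : ℕ → ℕ → ℂ → ℝ} {M : ℕ → ℝ} (hφ : ∀ n, IsUnitWeight (φ n) (M n))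
    (hF : ∀ n t z, φ n t z ≠ 0 → z ∈ F n t) :
    ∃ E : Set ℂ, IsCompact E ∧ 0 < hausdorffMeasureOf h ℂ E ∧ ∀ n, ∃ t, E ⊆ F n t := by
  set K : Set ℂ := Metric.closedBall 0 1
  have hK : IsCompact K := isCompact_closedBall 0 1
  have hnet : ∀ j : ℕ, ∃ N : Finset ℂ, K ⊆ ⋃ x ∈ N, Metric.closedBall x ((1 / 2) ^ j) := fun j => by
    obtain ⟨N, _, hN⟩ := hK.elim_nhds_subcover (fun x => Metric.closedBall x ((1 / 2) ^ j))
      fun x _ => Metric.closedBall_mem_nhds x (by positivity)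
    exact ⟨N, hN⟩
  choose N hN using hnet
  obtain ⟨τ, c, hc, hτ⟩ := exists_frequencies
    (B := fun i : (Σ j, N j) => Metric.closedBall (i.2 : ℂ) (3 * (1 / 2) ^ i.1))
    (b := fun i => h ((1 / 2) ^ i.1))
    (fun i => Metric.isClosed_closedBall.measurableSet) (fun i => measure_closedBall_lt_top.ne)
    (fun i => hh.pos _ (by positivity)) (eventually_mul_volume_closedBall_lt hprec hh.pos N)
    hK (Metric.measure_closedBall_pos _ _ one_pos) hφ hF
  have hclosed : ∀ k, IsClosed (⋂ n < k, F n (τ n)) := fun k =>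
    isClosed_biInter fun n _ => hFc n _
  refine ⟨⋂ k, K ∩ ⋂ n < k, F n (τ n), ?_, ?_, fun n => ⟨τ n, fun z hz => ?_⟩⟩
  · exact hK.of_isClosed_subset (isClosed_iInter fun k => hK.isClosed.inter (hclosed k))
      ((Set.iInter_subset _ 0).trans Set.inter_subset_left)
  · refine hausdorffMeasureOf_iInter_pos hh (fun k => hK.inter_right (hclosed k)) ?_
      (fun j => Set.inter_subset_left.trans (hN j)) hc hτ
    exact fun k l hkl => Set.inter_subset_inter_right _
      (Set.biInter_mono (fun n hn => lt_of_lt_of_le hn hkl) fun _ _ => le_rfl)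
  · exact Set.mem_iInter₂.1 (Set.mem_iInter.1 hz (n + 1)).2 n n.lt_succ_self

/-! ### Strips that exclude an affine relation -/

/-- The real part of multiplication by `a`. -/
noncomputable def reMul (a : ℂ) : StrongDual ℝ ℂ :=
  Complex.reCLM.comp (ContinuousLinearMap.mul ℝ ℂ a)

@[simp] theorem reMul_apply (a z : ℂ) : reMul a z = (a * z).re := rfl

theorem reMul_ne_zero {a : ℂ} (ha : a ≠ 0) : reMul a ≠ 0 := fun h => by
  have := congrArg (fun l : StrongDual ℝ ℂ => l a⁻¹) h
  simp [ha] at this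

theorem isClosed_strip (l : StrongDual ℝ ℂ) (t : ℝ) (a : UnitAddCircle) (r : ℝ) :
    IsClosed {z | ‖((t * l z : ℝ) : UnitAddCircle) - a‖ ≤ r} :=
  isClosed_le ((continuous_coe_mul_apply l t).sub continuous_const).norm continuous_const

/-- The relation `z₃ = (1 - m) z₁ + m z₂` cannot hold if the real parts of `(1 - m) z₁`, `m z₂` are
close to integer multiples of `1 / t`, and that of `z₃` is close to a half-integer multiple. -/
theorem ne_of_mem_strips {m z₁ z₂ z₃ : ℂ} {t : ℝ}
    (h₁ : ‖((t * reMul (1 - m) z₁ : ℝ) : UnitAddCircle) - 0‖ ≤ 1 / 8)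
    (h₂ : ‖((t * reMul m z₂ : ℝ) : UnitAddCircle) - 0‖ ≤ 1 / 8)
    (h₃ : ‖((t * reMul 1 z₃ : ℝ) : UnitAddCircle) - ((1 / 2 : ℝ) : UnitAddCircle)‖ ≤ 1 / 8) :
    z₃ ≠ (1 - m) * z₁ + m * z₂ := by
  rintro rfl
  rw [sub_zero] at h₁ h₂
  have hsum : t * reMul 1 ((1 - m) * z₁ + m * z₂) = t * reMul (1 - m) z₁ + t * reMul m z₂ := by
    simp only [reMul_apply, one_mul, Complex.add_re, mul_add]
  have hhalf : ‖((1 / 2 : ℝ) : UnitAddCircle)‖ = 1 / 2 := by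
    simpa using AddCircle.norm_half_period_eq (p := (1 : ℝ))
  rw [hsum, AddCircle.coe_add] at h₃
  set a := ((t * reMul (1 - m) z₁ : ℝ) : UnitAddCircle)
  set b := ((t * reMul m z₂ : ℝ) : UnitAddCircle)
  set c := ((1 / 2 : ℝ) : UnitAddCircle)
  -- This would give `1/2 ≤ 3 * (1/8)`.
  have h4 : ‖c‖ ≤ ‖a‖ + ‖b‖ + ‖a + b - c‖ := by
    calc ‖c‖ = ‖a + b - (a + b - c)‖ := by congr 1; abel
      _ ≤ ‖a + b‖ + ‖a + b - c‖ := norm_sub_le _ _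
      _ ≤ _ := by gcongr; exact norm_add_le _ _
  linarith

-- Disjoint regions can carry separate strip conditions without conflict. Each condition is an
-- implication from membership in an open region, hence closed, and points outside the regions stay
-- free. Overlapping regions get the trivial constraint, so that all index triples can be
-- enumerated.
open Classical in
theorem exists_constraint {m : ℂ} (hm0 : m ≠ 0) (hm1 : m ≠ 1) {B₁ B₂ B₃ : Set ℂ} (h₁ : IsOpen B₁)
    (h₂ : IsOpen B₂) (h₃ : IsOpen B₃) :
    ∃ (F : ℕ → Set ℂ) (φ : ℕ → ℂ → ℝ) (M : ℝ), (∀ t, IsClosed (F t)) ∧ IsUnitWeight φ M ∧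
      (∀ t z, φ t z ≠ 0 → z ∈ F t) ∧
      (Disjoint B₁ B₂ → Disjoint B₁ B₃ → Disjoint B₂ B₃ → ∀ t, ∀ z₁ ∈ B₁, ∀ z₂ ∈ B₂, ∀ z₃ ∈ B₃,
        z₁ ∈ F t → z₂ ∈ F t → z₃ ∈ F t → z₃ ≠ (1 - m) * z₁ + m * z₂) := by
  by_cases hd : Disjoint B₁ B₂ ∧ Disjoint B₁ B₃ ∧ Disjoint B₂ B₃
  swap
  · exact ⟨fun _ => Set.univ, fun _ _ => 1, 1, fun _ => isClosed_univ, isUnitWeight_one,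
      fun _ _ _ => trivial, fun h h' h'' => absurd ⟨h, h', h''⟩ hd⟩
  obtain ⟨h12, h13, h23⟩ := hd
  have h8 : (0 : ℝ) < 1 / 8 := by norm_num
  obtain ⟨φ₁, M₁, hφ₁, hs₁⟩ :=
    exists_isUnitWeight_strip (reMul (1 - m)) (reMul_ne_zero (sub_ne_zero.2 hm1.symm)) 0 h8
  obtain ⟨φ₂, M₂, hφ₂, hs₂⟩ := exists_isUnitWeight_strip (reMul m) (reMul_ne_zero hm0) 0 h8
  obtain ⟨φ₃, M₃, hφ₃, hs₃⟩ := exists_isUnitWeight_strip (reMul 1) (reMul_ne_zero one_ne_zero)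
    ((1 / 2 : ℝ) : UnitAddCircle) h8
  refine ⟨fun t => {z |
      (z ∈ B₁ → ‖((t * reMul (1 - m) z : ℝ) : UnitAddCircle) - 0‖ ≤ 1 / 8) ∧
      (z ∈ B₂ → ‖((t * reMul m z : ℝ) : UnitAddCircle) - 0‖ ≤ 1 / 8) ∧
      (z ∈ B₃ → ‖((t * reMul 1 z : ℝ) : UnitAddCircle) - ((1 / 2 : ℝ) : UnitAddCircle)‖ ≤ 1 / 8)},
    _, _, fun t => ?_, hφ₁.piecewise (hφ₂.piecewise (hφ₃.piecewise isUnitWeight_one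
      h₃.measurableSet) h₂.measurableSet) h₁.measurableSet, fun t z hz => ⟨fun hB => ?_,
    fun hB => ?_, fun hB => ?_⟩, fun _ _ _ t z₁ hz₁ z₂ hz₂ z₃ hz₃ hF₁ hF₂ hF₃ =>
      ne_of_mem_strips (hF₁.1 hz₁) (hF₂.2.1 hz₂) (hF₃.2.2 hz₃)⟩
  · exact (isClosed_imp h₁ (isClosed_strip _ _ _ _)).and ((isClosed_imp h₂
      (isClosed_strip _ _ _ _)).and (isClosed_imp h₃ (isClosed_strip _ _ _ _)))
  · rw [Set.piecewise_eq_of_mem _ _ _ hB] at hz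
    exact hs₁ t z hz
  · rw [Set.piecewise_eq_of_notMem _ _ _ (h12.notMem_of_mem_right hB),
      Set.piecewise_eq_of_mem _ _ _ hB] at hz
    exact hs₂ t z hz
  · rw [Set.piecewise_eq_of_notMem _ _ _ (h13.notMem_of_mem_right hB),
      Set.piecewise_eq_of_notMem _ _ _ (h23.notMem_of_mem_right hB),
      Set.piecewise_eq_of_mem _ _ _ hB] at hz
    exact hs₃ t z hz

theorem exists_disjoint_mem_basis {B : ℕ → Set ℂ}
    (hB : TopologicalSpace.IsTopologicalBasis (Set.range B)) {z₁ z₂ z₃ : ℂ} (h12 : z₁ ≠ z₂)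
    (h13 : z₁ ≠ z₃) (h23 : z₂ ≠ z₃) : ∃ i j k, z₁ ∈ B i ∧ z₂ ∈ B j ∧ z₃ ∈ B k ∧
      Disjoint (B i) (B j) ∧ Disjoint (B i) (B k) ∧ Disjoint (B j) (B k) := by
  obtain ⟨U₁, U₂, hU₁, hU₂, h1, h2, hU⟩ := t2_separation h12
  obtain ⟨V₁, V₃, hV₁, hV₃, h1', h3, hV⟩ := t2_separation h13
  obtain ⟨W₂, W₃, hW₂, hW₃, h2', h3', hW⟩ := t2_separation h23
  obtain ⟨_, ⟨i, rfl⟩, hi, hi'⟩ := hB.exists_subset_of_mem_open (Set.mem_inter h1 h1') (hU₁.inter hV₁)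
  obtain ⟨_, ⟨j, rfl⟩, hj, hj'⟩ := hB.exists_subset_of_mem_open (Set.mem_inter h2 h2') (hU₂.inter hW₂)
  obtain ⟨_, ⟨k, rfl⟩, hk, hk'⟩ := hB.exists_subset_of_mem_open (Set.mem_inter h3 h3') (hV₃.inter hW₃)
  exact ⟨i, j, k, hi, hj, hk,
    hU.mono (hi'.trans Set.inter_subset_left) (hj'.trans Set.inter_subset_left),
    hV.mono (hi'.trans Set.inter_subset_right) (hk'.trans Set.inter_subset_left),
    hW.mono (hj'.trans Set.inter_subset_right) (hk'.trans Set.inter_subset_right)⟩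

/-- A compact set of positive `h`-measure without distinct points satisfying one of countably many
relations `z₃ = (1 - m) z₁ + m z₂`. -/
theorem exists_isCompact_forall_ne {h : ℝ≥0 → ℝ≥0} (hh : IsDimensionFunction h)
    (hprec : DimPrec h fun t => t ^ 2) {m : ℕ → ℂ} (hm0 : ∀ n, m n ≠ 0) (hm1 : ∀ n, m n ≠ 1) :
    ∃ E : Set ℂ, IsCompact E ∧ 0 < hausdorffMeasureOf h ℂ E ∧
      ∀ n, ∀ z₁ ∈ E, ∀ z₂ ∈ E, ∀ z₃ ∈ E, z₁ ≠ z₂ → z₁ ≠ z₃ → z₂ ≠ z₃ →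
        z₃ ≠ (1 - m n) * z₁ + m n * z₂ := by
  have hbasis := TopologicalSpace.isBasis_countableBasis ℂ
  have hne : (TopologicalSpace.countableBasis ℂ).Nonempty := by
    obtain ⟨s, hs, _⟩ := hbasis.exists_subset_of_mem_open (Set.mem_univ (0 : ℂ)) isOpen_univ
    exact ⟨s, hs⟩
  obtain ⟨B, hB⟩ := (TopologicalSpace.countable_countableBasis ℂ).exists_eq_range hne
  rw [hB] at hbasis
  have hBo : ∀ i, IsOpen (B i) := fun i => hbasis.isOpen (Set.mem_range_self i)
  obtain ⟨e, he⟩ := exists_surjective_nat (ℕ × ℕ × ℕ × ℕ)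
  choose F φ M hFc hφ hF hav using fun q => exists_constraint (hm0 (e q).1) (hm1 (e q).1)
    (hBo (e q).2.1) (hBo (e q).2.2.1) (hBo (e q).2.2.2)
  obtain ⟨E, hE, hpos, hsub⟩ := exists_isCompact_hausdorffMeasureOf_pos hh hprec hFc hφ hF
  refine ⟨E, hE, hpos, fun n z₁ h1 z₂ h2 z₃ h3 h12 h13 h23 => ?_⟩
  obtain ⟨i, j, k, hi, hj, hk, hij, hik, hjk⟩ := exists_disjoint_mem_basis hbasis h12 h13 h23
  obtain ⟨q, hq⟩ := he (n, i, j, k)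
  obtain ⟨t, ht⟩ := hsub q
  have := hav q
  simp only [hq] at this
  exact this hij hik hjk t z₁ hi z₂ hj z₃ hk (ht h1) (ht h2) (ht h3)

/-! ### From similar copies to affine relations -/

/-- Circles centred at `0` and `1` meet in points that are mirror images in the real axis. -/
theorem eq_or_eq_conj_of_norm_eq {u v : ℂ} (h0 : ‖u‖ = ‖v‖) (h1 : ‖u - 1‖ = ‖v - 1‖) :
    u = v ∨ u = (starRingEnd ℂ) v := by
  have h0' := congrArg (· ^ 2) h0
  have h1' := congrArg (· ^ 2) h1
  simp only [← Complex.normSq_eq_norm_sq, Complex.normSq_apply, Complex.sub_re, Complex.sub_im,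
    Complex.one_re, Complex.one_im] at h0' h1'
  have hre : u.re = v.re := by linarith
  have him : (u.im - v.im) * (u.im + v.im) = 0 := by rw [hre] at h0'; linarith
  rcases mul_eq_zero.1 him with h | h
  · exact Or.inl (Complex.ext hre (by linarith))
  · exact Or.inr (Complex.ext (by simpa using hre) (by simp; linarith))

/-- A similarity preserves the shape of a triple up to complex conjugation. -/
theorem dilationEquiv_apply_eq (f : ℂ ≃ᵈ ℂ) {x y z : ℂ} (hxy : x ≠ y) {m : ℂ}
    (hm : m = (z - x) / (y - x)) :
    ∃ m', (m' = m ∨ m' = (starRingEnd ℂ) m) ∧ f z = (1 - m') * f x + m' * f y := by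
  have hyx : y - x ≠ 0 := sub_ne_zero.2 hxy.symm
  have hf : f y - f x ≠ 0 := sub_ne_zero.2 (f.injective.ne hxy.symm)
  have hr : Dilation.ratio f ≠ 0 := Dilation.ratio_ne_zero f
  have hn : ∀ a b, ‖f a - f b‖ = Dilation.ratio f * ‖a - b‖ := fun a b => by
    rw [← dist_eq_norm, ← dist_eq_norm, Dilation.dist_eq]
  have hr' : (Dilation.ratio f : ℝ) ≠ 0 := NNReal.coe_ne_zero.2 hr
  -- The witness is the shape of the image; the ratio of `f` cancels in its distances to `0` and
  -- `1`.
  refine ⟨(f z - f x) / (f y - f x), eq_or_eq_conj_of_norm_eq ?_ ?_, by field_simp; ring⟩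
  · rw [hm, norm_div, norm_div, hn, hn, mul_div_mul_left _ _ hr']
  · rw [hm, div_sub_one hf, div_sub_one hyx, sub_sub_sub_cancel_right, sub_sub_sub_cancel_right,
      norm_div, norm_div, hn, hn, mul_div_mul_left _ _ hr']

theorem exists_isCompact_not_containsSimilarCopy {x y z : ℕ → ℂ} (hxy : ∀ n, x n ≠ y n)
    (hxz : ∀ n, x n ≠ z n) (hyz : ∀ n, y n ≠ z n) {h : ℝ≥0 → ℝ≥0} (hh : IsDimensionFunction h)
    (hprec : DimPrec h fun t => t ^ 2) :
    ∃ E : Set ℂ, IsCompact E ∧ 0 < hausdorffMeasureOf h ℂ E ∧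
      ∀ n, ¬ ContainsSimilarCopy E {x n, y n, z n} := by
  let a : ℕ → ℂ := fun n => (z n - x n) / (y n - x n)
  have ha0 : ∀ n, a n ≠ 0 := fun n =>
    div_ne_zero (sub_ne_zero.2 (hxz n).symm) (sub_ne_zero.2 (hxy n).symm)
  have ha1 : ∀ n, a n ≠ 1 := fun n h => by
    rw [div_eq_one_iff_eq (sub_ne_zero.2 (hxy n).symm), sub_left_inj] at h
    exact hyz n h.symm
  -- Even indices list the shapes, odd ones their conjugates, which account for reflections.
  let m : ℕ → ℂ := fun n => if Even n then a (n / 2) else (starRingEnd ℂ) (a (n / 2))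
  have hm0 : ∀ n, m n ≠ 0 := fun n => by
    dsimp only [m]; split_ifs <;> simp [ha0]
  have hm1 : ∀ n, m n ≠ 1 := fun n => by
    dsimp only [m]; split_ifs
    · exact ha1 _
    · exact fun h => ha1 (n / 2) (by simpa using congrArg (starRingEnd ℂ) h)
  obtain ⟨E, hE, hpos, hne⟩ := exists_isCompact_forall_ne hh hprec hm0 hm1
  refine ⟨E, hE, hpos, fun n ⟨f, hf⟩ => ?_⟩
  rw [Set.image_subset_iff] at hf
  have hx : f (x n) ∈ E := hf (by simp)
  have hy : f (y n) ∈ E := hf (by simp)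
  have hz : f (z n) ∈ E := hf (by simp)
  obtain ⟨m', hm', heq⟩ := dilationEquiv_apply_eq f (hxy n) (m := a n) (z := z n) rfl
  have hk : ∃ k, m k = m' := by
    rcases hm' with rfl | rfl
    · exact ⟨2 * n, by simp [m]⟩
    · refine ⟨2 * n + 1, ?_⟩
      have h1 : (2 * n + 1) / 2 = n := by omega
      simp [m, h1]
  obtain ⟨k, rfl⟩ := hk
  exact hne k _ hx _ hy _ hz (f.injective.ne (hxy n)) (f.injective.ne (hxz n))
    (f.injective.ne (hyz n)) heq

/-! ### The gauge `x² log (e / x)` and Hausdorff dimension two -/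

/-- The real function `m (m - m log m)` of `m = min x 1`, that is, `x² log (e / x)` for `x ≤ 1`. -/
noncomputable def sqMulLogGauge (x : ℝ) : ℝ :=
  min x 1 * (min x 1 + Real.negMulLog (min x 1))

theorem continuous_sqMulLogGauge : Continuous sqMulLogGauge := by
  unfold sqMulLogGauge
  have := Real.continuous_negMulLog
  fun_prop

/-- The derivative of `x - x log x` is `-log x`, nonnegative on `(0, 1]`; without the summand `x`,
monotonicity would fail near `1`. The inequality `log u ≤ u - 1` replaces calculus. -/
theorem add_negMulLog_mono {a b : ℝ} (ha : 0 ≤ a) (hab : a ≤ b) (hb : b ≤ 1) :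
    a + Real.negMulLog a ≤ b + Real.negMulLog b := by
  rcases ha.eq_or_lt with rfl | ha
  · simpa using add_nonneg hab (Real.negMulLog_nonneg hab hb)
  have hb0 : 0 < b := ha.trans_le hab
  have h1 : a * (Real.log b - Real.log a) ≤ b - a := by
    rw [← Real.log_div hb0.ne' ha.ne']
    calc a * Real.log (b / a) ≤ a * (b / a - 1) := by
          gcongr; exact Real.log_le_sub_one_of_pos (by positivity)
      _ = b - a := by field_simp
  have h2 : 0 ≤ (b - a) * -Real.log b :=
    mul_nonneg (sub_nonneg.2 hab) (neg_nonneg.2 (Real.log_nonpos hb0.le hb))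
  simp only [Real.negMulLog]
  linarith

theorem sqMulLogGauge_mono {x y : ℝ} (hx : 0 ≤ x) (hxy : x ≤ y) :
    sqMulLogGauge x ≤ sqMulLogGauge y := by
  have h0 : 0 ≤ min x 1 := le_min hx zero_le_one
  have h1 : min x 1 ≤ min y 1 := min_le_min_right _ hxy
  exact mul_le_mul h1 (add_negMulLog_mono h0 h1 (min_le_right _ _))
    (add_nonneg h0 (Real.negMulLog_nonneg h0 (min_le_right _ _))) (h0.trans h1)

theorem sqMulLogGauge_pos {x : ℝ} (hx : 0 < x) : 0 < sqMulLogGauge x := by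
  have h0 : 0 < min x 1 := lt_min hx one_pos
  exact mul_pos h0 (add_pos_of_pos_of_nonneg h0 (Real.negMulLog_nonneg h0.le (min_le_right _ _)))

theorem sqMulLogGauge_of_le_one {x : ℝ} (hx : x ≤ 1) :
    sqMulLogGauge x = x ^ 2 * (1 - Real.log x) := by
  rw [sqMulLogGauge, min_eq_left hx, Real.negMulLog]
  ring

theorem isDimensionFunction_sqMulLogGauge :
    IsDimensionFunction fun x => (sqMulLogGauge x).toNNReal where
  map_zero := by simp [sqMulLogGauge]
  pos t ht := Real.toNNReal_pos.2 (sqMulLogGauge_pos (NNReal.coe_pos.2 ht))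
  mono _ _ hxy := Real.toNNReal_mono (sqMulLogGauge_mono (NNReal.coe_nonneg _) hxy)
  right_continuous _ := (continuous_real_toNNReal.comp
    (continuous_sqMulLogGauge.comp NNReal.continuous_coe)).continuousWithinAt

theorem dimPrec_sqMulLogGauge :
    DimPrec (fun x => (sqMulLogGauge x).toNNReal) fun t => t ^ 2 := by
  have hcoe : Tendsto ((↑) : ℝ≥0 → ℝ) (𝓝[>] 0) (𝓝[>] 0) :=
    tendsto_nhdsWithin_iff.2 ⟨(NNReal.continuous_coe.tendsto' 0 0 rfl).mono_left nhdsWithin_le_nhds,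
      eventually_mem_nhdsWithin⟩
  have h1 : Tendsto (fun x : ℝ => (1 - Real.log x)⁻¹) (𝓝[>] 0) (𝓝 0) := by
    refine tendsto_inv_atTop_zero.comp ?_
    simp_rw [sub_eq_add_neg]
    exact tendsto_atTop_add_const_left _ _ (tendsto_neg_atBot_atTop.comp
      Real.tendsto_log_nhdsGT_zero)
  rw [DimPrec, ← NNReal.tendsto_coe, NNReal.coe_zero]
  refine (h1.comp hcoe).congr' ?_
  have h2 : ∀ᶠ x : ℝ≥0 in 𝓝[>] 0, x ∈ Set.Ioo (0 : ℝ≥0) 1 := Ioo_mem_nhdsGT one_pos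
  filter_upwards [h2] with x hx
  have hx0 : (0 : ℝ) < x := hx.1
  have hx1 : (x : ℝ) ≤ 1 := NNReal.coe_le_one.2 hx.2.le
  simp only [Function.comp_apply, NNReal.coe_div, NNReal.coe_pow]
  rw [Real.coe_toNNReal _ (sqMulLogGauge_pos hx0).le, sqMulLogGauge_of_le_one hx1,
    div_mul_cancel_left₀ (by positivity)]

/-- The factor `1 - log x` is beaten by the positive power `x ^ (2 - s)`. -/
theorem eventually_sqMulLogGauge_le_rpow {s : ℝ} (hs : s < 2) :
    ∀ᶠ x in 𝓝[>] (0 : ℝ), sqMulLogGauge x ≤ x ^ s := by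
  have h1 : Tendsto (fun x : ℝ => x ^ (2 - s) - Real.log x * x ^ (2 - s)) (𝓝[>] 0) (𝓝 0) := by
    have h := (Real.continuousAt_rpow_const 0 (2 - s) (Or.inr (by linarith))).tendsto.mono_left
      (nhdsWithin_le_nhds (s := Set.Ioi 0))
    rw [Real.zero_rpow (by linarith)] at h
    simpa using h.sub (tendsto_log_mul_rpow_nhdsGT_zero (sub_pos.2 hs))
  filter_upwards [h1.eventually_le_const one_pos, Ioo_mem_nhdsGT one_pos] with x hx hx01
  have hx0 : 0 < x := hx01.1
  have h2 : x ^ 2 = x ^ s * x ^ (2 - s) := by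
    rw [← Real.rpow_add hx0, add_sub_cancel, Real.rpow_two]
  rw [sqMulLogGauge_of_le_one hx01.2.le, h2]
  calc x ^ s * x ^ (2 - s) * (1 - Real.log x)
      = x ^ s * (x ^ (2 - s) - Real.log x * x ^ (2 - s)) := by ring
    _ ≤ x ^ s := mul_le_of_le_one_right (by positivity) hx

/-- For each `s < 2` the gauge is at most `x ^ s` at small scales, so positive measure for it forces
positive `s`-dimensional measure. -/
theorem dimH_eq_two_of_hausdorffMeasureOf_pos {E : Set ℂ}
    (hE : 0 < hausdorffMeasureOf (fun x => (sqMulLogGauge x).toNNReal) ℂ E) : dimH E = 2 := by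
  refine le_antisymm ?_ (ENNReal.le_of_forall_nnreal_lt fun s hs => ?_)
  · calc dimH E ≤ dimH (Set.univ : Set ℂ) := dimH_mono (Set.subset_univ _)
      _ = 2 := by rw [Real.dimH_univ_eq_finrank, Complex.finrank_real_complex]; norm_num
  · refine le_dimH_of_hausdorffMeasure_ne_zero (hE.trans_le ?_).ne'
    refine Measure.mkMetric_mono ?_ E
    have hs2 : (s : ℝ) < 2 := by exact_mod_cast hs
    obtain ⟨δ, hδ, hδs⟩ :=
      mem_nhdsGT_iff_exists_Ioo_subset.1 (eventually_sqMulLogGauge_le_rpow hs2)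
    filter_upwards [Iio_mem_nhds (ENNReal.ofReal_pos.2 (show 0 < δ from hδ))] with d hd
    have hdtop : d ≠ ∞ := (lt_trans hd ENNReal.ofReal_lt_top).ne
    lift d to ℝ≥0 using hdtop
    rw [if_neg ENNReal.coe_ne_top, ENNReal.toNNReal_coe]
    rcases eq_or_ne d 0 with rfl | hd0
    · simp [sqMulLogGauge]
    have hd0' : 0 < (d : ℝ) := NNReal.coe_pos.2 (pos_iff_ne_zero.2 hd0)
    rw [← ENNReal.coe_rpow_of_nonneg _ s.coe_nonneg, ENNReal.coe_le_coe, Real.toNNReal_le_iff_le_coe,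
      NNReal.coe_rpow]
    refine hδs ⟨hd0', ?_⟩
    rw [Set.mem_Iio, ← ENNReal.ofReal_coe_nnreal, ENNReal.ofReal_lt_ofReal_iff hδ] at hd
    exact hd

theorem mainTheorem10 (x y z : ℕ → ℂ)
    (hxy : ∀ n, x n ≠ y n) (hxz : ∀ n, x n ≠ z n) (hyz : ∀ n, y n ≠ z n) :
    (∀ h : ℝ≥0 → ℝ≥0, IsDimensionFunction h → DimPrec h (fun t => t ^ 2) →
      ∃ E : Set ℂ, IsCompact E ∧ 0 < hausdorffMeasureOf h ℂ E ∧
        ∀ n, ¬ ContainsSimilarCopy E {x n, y n, z n}) ∧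
    (∃ E : Set ℂ, IsCompact E ∧ dimH E = 2 ∧
      ∀ n, ¬ ContainsSimilarCopy E {x n, y n, z n}) := by
  refine ⟨fun h hh hprec => exists_isCompact_not_containsSimilarCopy hxy hxz hyz hh hprec, ?_⟩
  obtain ⟨E, hE, hpos, hcopy⟩ := exists_isCompact_not_containsSimilarCopy hxy hxz hyz
    isDimensionFunction_sqMulLogGauge dimPrec_sqMulLogGauge
  exact ⟨E, hE, dimH_eq_two_of_hausdorffMeasureOf_pos hpos, hcopy⟩
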